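/- Let $(\mathbb X,\mathcal X)$ be a measurable space, $V:\mathbb X\to[1,\infty)$ a measurable function, and let $\mathcal B_1$ be the Banach space of measurable functions $f:\mathbb X\to\mathbb C$ with $\|f\|_1:=\sup_{x}|f(x)|V(x)^{-1}<\infty$. Let $P$ be a Markov kernel on $(\mathbb X,\mathcal X)$, let $S\in\mathcal X$, and let $\nu$ be a non-zero positive measure on $(\mathbb X,\mathcal X)$. Write $\nu(f)=\int f\,d\nu$, $(Pf)(x)=\int f(y)\,P(x,dy)$, and $1=1_{\mathbb X}$. Suppose that for some $\delta\in(0,1)$ and $L>0$ $$PV\le \delta V+L\,1_S,\qquad\text{and}\qquad P(x,A)\ge \nu(A)\,1_S(x)\quad\text{for all }x\in\mathbb X,\ A\in\mathcal X .$$ For a bounded operator $T$ with spectral radius $1$ on a complex Banach space $\mathcal B$ and $r_0\in(0,1)$, say that $T$ splits at $r_0$ if there are $m\ge1$, $(\lambda_i,p_i)\in\mathbb C\times\{1,2,\dots\}$ for $i=1,\dots,m$, and a closed $T$-invariant subspace $H$ with $$\mathcal B=\bigoplus_{i=1}^m\ker(T-\lambda_iI)^{p_i}\oplus H,\qquad |\lambda_i|\ge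 r_0,\qquad 1\le\dim\ker(T-\lambda_iI)^{p_i}<\infty,\qquad \inf_{n\ge1}\Big(\sup_{h\in H,\ \|h\|\le1}\|T^nh\|\Big)^{1/n}<r_0 .$$ $T$ is quasi-compact if it splits at some $r_0\in(0,1)$, and then its essential spectral radius $r_{ess}(T)$ is the infimum of all $r_0\in(0,1)$ at which it splits. Then $P$ defines a bounded operator on $\mathcal B_1$ which is power-bounded ($\sup_{n\ge0}\|P^n\|<\infty$), has spectral radius $1$, and is quasi-compact; moreover $\nu(1)<\infty$, $\nu(V)<\infty$, and $$r_{ess}(P)\le\frac{\delta\,\nu(1)+\tau}{\nu(1)+\tau},\qquad \tau:=\max\big(0,\,L-\nu(V)\big).$$ No irreducibility or aperiodicity is assumed. -/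

import Mathlib

open MeasureTheory ProbabilityTheory
open scoped ENNReal

namespace DriftMinorization

/-- A measurable weight `V : X → [1, ∞)`. -/
structure Weight (X : Type*) [MeasurableSpace X] where
  toFun : X → ℝ
  measurable_toFun : Measurable toFun
  one_le_toFun : ∀ x, 1 ≤ toFun x

instance {X : Type*} [MeasurableSpace X] : CoeFun (Weight X) (fun _ => X → ℝ) :=
  ⟨Weight.toFun⟩

theorem Weight.pos {X : Type*} [MeasurableSpace X] (V : Weight X) (x : X) : 0 < V x :=
  lt_of_lt_of_le one_pos (V.one_le_toFun x)

/-- The linear space of measurable `f : X → ℂ` with `sup_x |f x| / V x < ∞`. -/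
def weightedSubmodule {X : Type*} [MeasurableSpace X] (V : Weight X) :
    Submodule ℂ (X → ℂ) where
  carrier := {f | Measurable f ∧ BddAbove (Set.range fun x => ‖f x‖ * (V x)⁻¹)}
  zero_mem' := ⟨measurable_const, 0, by rintro _ ⟨x, rfl⟩; simp⟩
  add_mem' := by
    rintro f g ⟨hf, a, ha⟩ ⟨hg, b, hb⟩
    refine ⟨hf.add hg, a + b, ?_⟩
    rintro _ ⟨x, rfl⟩
    have h1 : ‖f x‖ * (V x)⁻¹ ≤ a := ha ⟨x, rfl⟩
    have h2 : ‖g x‖ * (V x)⁻¹ ≤ b := hb ⟨x, rfl⟩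
    have h3 : ‖f x + g x‖ * (V x)⁻¹ ≤ (‖f x‖ + ‖g x‖) * (V x)⁻¹ :=
      mul_le_mul_of_nonneg_right (norm_add_le _ _) (inv_nonneg.2 (V.pos x).le)
    simp only [Pi.add_apply]
    linarith [add_mul ‖f x‖ ‖g x‖ (V x)⁻¹]
  smul_mem' := by
    rintro c f ⟨hf, a, ha⟩
    refine ⟨hf.const_smul c, ‖c‖ * a, ?_⟩
    rintro _ ⟨x, rfl⟩
    have h1 : ‖f x‖ * (V x)⁻¹ ≤ a := ha ⟨x, rfl⟩
    simp only [Pi.smul_apply, norm_smul, mul_assoc]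
    exact mul_le_mul_of_nonneg_left h1 (norm_nonneg c)

/-- The weighted supremum space `𝓑₁`. This is a type of its own, so that it does not inherit the
topology of pointwise convergence from `X → ℂ`. -/
def WeightedSup {X : Type*} [MeasurableSpace X] (V : Weight X) : Type _ :=
  ↥(weightedSubmodule V)

namespace WeightedSup

variable {X : Type*} [MeasurableSpace X] {V : Weight X}

instance : AddCommGroup (WeightedSup V) := inferInstanceAs (AddCommGroup ↥(weightedSubmodule V))

instance : Module ℂ (WeightedSup V) := inferInstanceAs (Module ℂ ↥(weightedSubmodule V))

instance : CoeFun (WeightedSup V) (fun _ => X → ℂ) := ⟨fun f => f.1⟩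

theorem ext {f g : WeightedSup V} (h : ∀ x, f x = g x) : f = g := Subtype.ext (funext h)

theorem measurable (f : WeightedSup V) : Measurable (f : X → ℂ) := f.2.1

theorem bddAbove (f : WeightedSup V) : BddAbove (Set.range fun x => ‖f x‖ * (V x)⁻¹) := f.2.2

@[simp] theorem add_apply (f g : WeightedSup V) (x : X) : (f + g) x = f x + g x := rfl

@[simp] theorem sub_apply (f g : WeightedSup V) (x : X) : (f - g) x = f x - g x := rfl

@[simp] theorem smul_apply (c : ℂ) (f : WeightedSup V) (x : X) : (c • f) x = c * f x := rfl

@[simp] theorem zero_apply (x : X) : (0 : WeightedSup V) x = 0 := rfl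

/-- `‖f‖₁ = sup_x |f x| V(x)⁻¹`. -/
noncomputable instance : Norm (WeightedSup V) := ⟨fun f => ⨆ x, ‖f x‖ * (V x)⁻¹⟩

theorem norm_def (f : WeightedSup V) : ‖f‖ = ⨆ x, ‖f x‖ * (V x)⁻¹ := rfl

theorem norm_apply_le' (f : WeightedSup V) (x : X) : ‖f x‖ * (V x)⁻¹ ≤ ‖f‖ :=
  le_ciSup f.bddAbove x

theorem norm_apply_le (f : WeightedSup V) (x : X) : ‖f x‖ ≤ ‖f‖ * V x := by
  have h := norm_apply_le' f x
  rwa [← div_eq_mul_inv, div_le_iff₀ (V.pos x)] at h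

theorem norm_le_of_forall {f : WeightedSup V} {C : ℝ} (hC : 0 ≤ C)
    (h : ∀ x, ‖f x‖ ≤ C * V x) : ‖f‖ ≤ C := by
  refine Real.iSup_le (fun x => ?_) hC
  rw [← div_eq_mul_inv, div_le_iff₀ (V.pos x)]
  exact h x

theorem norm_nonneg' (f : WeightedSup V) : 0 ≤ ‖f‖ :=
  Real.iSup_nonneg fun x => mul_nonneg (norm_nonneg _) (inv_nonneg.2 (V.pos x).le)

theorem core : NormedSpace.Core ℂ (WeightedSup V) where
  norm_nonneg := norm_nonneg'
  norm_smul c f := by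
    simp only [norm_def, smul_apply, norm_mul, mul_assoc]
    exact (Real.mul_iSup_of_nonneg (norm_nonneg c) _).symm
  norm_triangle f g := by
    refine norm_le_of_forall (add_nonneg (norm_nonneg' f) (norm_nonneg' g)) fun x => ?_
    rw [add_mul]
    exact (norm_add_le _ _).trans (add_le_add (norm_apply_le f x) (norm_apply_le g x))
  norm_eq_zero_iff f := by
    refine ⟨fun h => ext fun x => ?_, ?_⟩
    · have h1 := norm_apply_le f x
      rw [h, zero_mul] at h1
      simpa using h1
    · rintro rfl
      simp [norm_def]

noncomputable instance : NormedAddCommGroup (WeightedSup V) := NormedAddCommGroup.ofCore core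

noncomputable instance : NormedSpace ℂ (WeightedSup V) := NormedSpace.ofCore core

instance : CompleteSpace (WeightedSup V) := by
  refine Metric.complete_of_cauchySeq_tendsto fun u hu => ?_
  have hpt : ∀ x, CauchySeq fun n => u n x := by
    intro x
    rw [Metric.cauchySeq_iff] at hu ⊢
    intro ε hε
    obtain ⟨N, hN⟩ := hu (ε / V x) (div_pos hε (V.pos x))
    refine ⟨N, fun m hm n hn => ?_⟩
    have h1 := hN m hm n hn
    rw [dist_eq_norm] at h1 ⊢
    have h2 := norm_apply_le (u m - u n) x
    exact h2.trans_lt ((lt_div_iff₀ (V.pos x)).1 h1)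
  choose g hg using fun x => cauchySeq_tendsto_of_complete (hpt x)
  have key : ∀ ε > 0, ∃ N, ∀ n ≥ N, ∀ x, ‖u n x - g x‖ ≤ ε * V x := by
    intro ε hε
    obtain ⟨N, hN⟩ := Metric.cauchySeq_iff.1 hu ε hε
    refine ⟨N, fun n hn x => ?_⟩
    refine le_of_tendsto ((tendsto_const_nhds.sub (hg x)).norm)
      (Filter.eventually_atTop.2 ⟨N, fun m hm => ?_⟩)
    have h1 := hN n hn m hm
    rw [dist_eq_norm] at h1
    exact (norm_apply_le (u n - u m) x).trans
      (mul_le_mul_of_nonneg_right h1.le (V.pos x).le)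
  have hgm : Measurable g :=
    measurable_of_tendsto_metrizable (fun n => (u n).measurable) (tendsto_pi_nhds.2 hg)
  obtain ⟨N, hN⟩ := key 1 one_pos
  have hgb : BddAbove (Set.range fun x => ‖g x‖ * (V x)⁻¹) := by
    refine ⟨‖u N‖ + 1, ?_⟩
    rintro _ ⟨x, rfl⟩
    simp only
    rw [← div_eq_mul_inv, div_le_iff₀ (V.pos x)]
    have h1 := hN N le_rfl x
    have h2 := norm_apply_le (u N) x
    have h3 : ‖g x‖ ≤ ‖u N x‖ + ‖u N x - g x‖ := by
      simpa using norm_sub_le (u N x) (u N x - g x)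
    linarith [add_mul ‖u N‖ 1 (V x)]
  let g' : WeightedSup V := (⟨g, hgm, hgb⟩ : ↥(weightedSubmodule V))
  refine ⟨g', Metric.tendsto_atTop.2 fun ε hε => ?_⟩
  obtain ⟨M, hM⟩ := key (ε / 2) (half_pos hε)
  refine ⟨M, fun n hn => ?_⟩
  rw [dist_eq_norm]
  exact (norm_le_of_forall (half_pos hε).le fun x => hM n hn x).trans_lt (half_lt_self hε)

end WeightedSup

/-- `PV / V` is bounded on `X`, where `(PV)(x) = ∫ V(y) P(x, dy)`. -/
def WeightBounded {X : Type*} [MeasurableSpace X] (V : Weight X) (P : Kernel X X) : Prop :=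
  ∃ C : ℝ, 0 ≤ C ∧ ∀ x, ∫⁻ y, ENNReal.ofReal (V y) ∂(P x) ≤ ENNReal.ofReal (C * V x)

section

variable {X : Type*} [MeasurableSpace X] {V : Weight X} {P : Kernel X X}

theorem WeightBounded.integrable_weight (h : WeightBounded V P) (x : X) :
    Integrable V.toFun (P x) := by
  obtain ⟨C, -, hC⟩ := h
  refine ⟨V.measurable_toFun.aestronglyMeasurable, ?_⟩
  rw [hasFiniteIntegral_iff_ofReal (Filter.Eventually.of_forall fun y => (V.pos y).le)]
  exact (hC x).trans_lt ENNReal.ofReal_lt_top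

theorem WeightBounded.integrable (h : WeightBounded V P) (f : WeightedSup V) (x : X) :
    Integrable (f : X → ℂ) (P x) :=
  ((h.integrable_weight x).const_mul ‖f‖).mono' f.measurable.aestronglyMeasurable
    (Filter.Eventually.of_forall fun y => WeightedSup.norm_apply_le f y)

theorem norm_integral_le_of_bound {C : ℝ} (hC0 : 0 ≤ C)
    (hC : ∀ x, ∫⁻ y, ENNReal.ofReal (V y) ∂(P x) ≤ ENNReal.ofReal (C * V x))
    (f : WeightedSup V) (x : X) : ‖∫ y, f y ∂(P x)‖ ≤ C * ‖f‖ * V x := by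
  have hi := WeightBounded.integrable_weight ⟨C, hC0, hC⟩ x
  have h1 : ‖∫ y, f y ∂(P x)‖ ≤ ∫ y, ‖f‖ * V y ∂(P x) :=
    norm_integral_le_of_norm_le (hi.const_mul _)
      (Filter.Eventually.of_forall fun y => WeightedSup.norm_apply_le f y)
  have h2 : ∫ y, V y ∂(P x) ≤ C * V x := by
    rw [integral_eq_lintegral_of_nonneg_ae (Filter.Eventually.of_forall fun y => (V.pos y).le)
      V.measurable_toFun.aestronglyMeasurable]
    exact ENNReal.toReal_le_of_le_ofReal (mul_nonneg hC0 (V.pos x).le) (hC x)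
  rw [integral_const_mul] at h1
  have h3 := mul_le_mul_of_nonneg_left h2 (norm_nonneg f)
  calc _ ≤ _ := h1
    _ ≤ _ := h3
    _ = _ := by ring

/-- The bounded operator on `𝓑₁` induced by a kernel: `(P f)(x) = ∫ f(y) P(x, dy)`. -/
noncomputable def kernelOp (V : Weight X) (P : Kernel X X) [IsMarkovKernel P]
    (h : WeightBounded V P) : WeightedSup V →L[ℂ] WeightedSup V :=
  LinearMap.mkContinuousOfExistsBound
    { toFun := fun f => ⟨fun x => ∫ y, f y ∂(P x),
        (f.measurable.stronglyMeasurable.integral_kernel (κ := P)).measurable, by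
          obtain ⟨C, hC0, hC⟩ := h
          refine ⟨C * ‖f‖, ?_⟩
          rintro _ ⟨x, rfl⟩
          simp only
          rw [← div_eq_mul_inv, div_le_iff₀ (V.pos x)]
          exact norm_integral_le_of_bound hC0 hC f x⟩
      map_add' := fun f g => WeightedSup.ext fun x =>
        integral_add (h.integrable f x) (h.integrable g x)
      map_smul' := fun c f => WeightedSup.ext fun x =>
        integral_const_mul c (fun y => f y) }
    (by
      obtain ⟨C, hC0, hC⟩ := h
      exact ⟨C, fun f => WeightedSup.norm_le_of_forall (mul_nonneg hC0 (norm_nonneg f))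
        fun x => norm_integral_le_of_bound hC0 hC f x⟩)

theorem kernelOp_apply [IsMarkovKernel P] (h : WeightBounded V P) (f : WeightedSup V) (x : X) :
    kernelOp V P h f x = ∫ y, f y ∂(P x) := rfl

end

/-- The drift condition `PV ≤ δ V + L 1_S`. -/
def Drift {X : Type*} [MeasurableSpace X] (V : Weight X) (P : Kernel X X)
    (S : Set X) (δ L : ℝ) : Prop :=
  ∀ x, ∫⁻ y, ENNReal.ofReal (V y) ∂(P x)
    ≤ ENNReal.ofReal (δ * V x + L * S.indicator (fun _ => (1 : ℝ)) x)

theorem Drift.weightBounded {X : Type*} [MeasurableSpace X] {V : Weight X} {P : Kernel X X}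
    {S : Set X} {δ L : ℝ} (h : Drift V P S δ L) (hδ : 0 < δ) (hL : 0 < L) :
    WeightBounded V P := by
  refine ⟨δ + L, by positivity, fun x => (h x).trans (ENNReal.ofReal_le_ofReal ?_)⟩
  have h1 : S.indicator (fun _ => (1 : ℝ)) x ≤ V x :=
    (Set.indicator_le_self' (fun _ _ => zero_le_one) x).trans (V.one_le_toFun x)
  have h2 := mul_le_mul_of_nonneg_left h1 hL.le
  linarith [add_mul δ L (V x)]

/-- The minorization condition `P(x, A) ≥ ν(A) 1_S(x)` for all `x` and all measurable `A`. -/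
def Minorization {X : Type*} [MeasurableSpace X] (P : Kernel X X) (S : Set X)
    (ν : Measure X) : Prop :=
  ∀ x, ∀ A, MeasurableSet A → S.indicator (fun _ => ν A) x ≤ P x A

section

variable {E : Type*} [NormedAddCommGroup E] [NormedSpace ℂ E]

/-- `sup_n ‖T ^ n‖ < ∞`. -/
def PowerBounded (T : E →L[ℂ] E) : Prop := ∃ C : ℝ, ∀ n : ℕ, ‖T ^ n‖ ≤ C

/-- The summands of `⨁ᵢ ker (T - λᵢ)^pᵢ ⊕ H`, with `none` indexing `H`. -/
def spectralSummand (T : E →L[ℂ] E) {m : ℕ} (lam : Fin m → ℂ) (p : Fin m → ℕ)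
    (H : Submodule ℂ E) : Option (Fin m) → Submodule ℂ E
  | none => H
  | some i => LinearMap.ker (((T - lam i • (1 : E →L[ℂ] E)) ^ p i : E →L[ℂ] E) : E →ₗ[ℂ] E)

/-- `E = ⨁ᵢ ker (T - λᵢ)^pᵢ ⊕ H` with `1 ≤ m`, `1 ≤ pᵢ`, `|λᵢ| ≥ r₀`, each
`ker (T - λᵢ)^pᵢ` nonzero of finite dimension, and `H` a closed `T`-invariant subspace with
`inf_{n ≥ 1} (sup {‖T^n h‖ : h ∈ H, ‖h‖ ≤ 1})^(1/n) < r₀`. -/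
def HasSpectralSplitting (T : E →L[ℂ] E) (r₀ : ℝ) : Prop :=
  ∃ (m : ℕ) (lam : Fin m → ℂ) (p : Fin m → ℕ) (H : Submodule ℂ E),
    1 ≤ m ∧ (∀ i, 1 ≤ p i) ∧
    DirectSum.IsInternal (spectralSummand T lam p H) ∧
    (∀ i, r₀ ≤ ‖lam i‖ ∧ spectralSummand T lam p H (some i) ≠ ⊥ ∧
      FiniteDimensional ℂ ↥(spectralSummand T lam p H (some i))) ∧
    IsClosed (H : Set E) ∧ (∀ h ∈ H, T h ∈ H) ∧
    (⨅ n : ℕ+, ‖(T ^ (n : ℕ)).comp H.subtypeL‖ ^ (1 / ((n : ℕ) : ℝ))) < r₀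

/-- Quasi-compactness of a bounded operator with spectral radius `1`. -/
def QuasiCompact (T : E →L[ℂ] E) : Prop :=
  ∃ r₀ : ℝ, 0 < r₀ ∧ r₀ < 1 ∧ HasSpectralSplitting T r₀

/-- The essential spectral radius of a quasi-compact bounded operator with spectral radius `1`. -/
noncomputable def essSpectralRadius (T : E →L[ℂ] E) : ℝ :=
  sInf {r₀ : ℝ | 0 < r₀ ∧ r₀ < 1 ∧ HasSpectralSplitting T r₀}

end

end DriftMinorization

/-! Write `P = R + ν(·) 1_S`, where `R` is the residual kernel left by the minorization. Drift and
mass balance give `R(V + τ/ν(1)) ≤ β (V + τ/ν(1))`, with `β` the claimed bound, so `‖R^n‖ ≤ const ·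
β^n` (`norm_residual_pow_le`) and `z - R` is invertible for `|z| > β`.

The rest is the spectral theory of a rank-one perturbation `T = R + ψ(·) φ`
(`hasSpectralSplitting_of_rankOne`). For `|z| > β` the operator `T - z` fails to be bijective
exactly at the zeros of the analytic function `1 - ψ((z - R)⁻¹ φ)`. A zero gives an eigenvector `(z
- R)⁻¹ φ`, and power-boundedness of `T` excludes zeros with `|z| > 1`; hence the function is not
identically zero, and has finitely many zeros with `|z| ≥ r` for each `r > β`. At a zero of order
`p`, `isRieszComplement_of_rankOne` gives an explicit closed complement of `ker (T - w)^p`. The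
intersection `H` of these complements is the remaining summand; there `T - z` is bijective for all
`|z| ≥ r`, so Gelfand's formula gives growth rate below `r`. Since `r > β` is arbitrary, the bound
follows. -/

namespace DriftMinorization

/-! ### Complements of generalized eigenspaces and their intersections. -/

section RieszComplement

variable {E : Type*} [NormedAddCommGroup E] [NormedSpace ℂ E]

/-- `H` is a closed `A`-invariant subspace on which `A` is bijective, containing the range of
`A ^ p`, and `ker (A ^ p)` is finite-dimensional. -/
structure IsRieszComplement (A : E →L[ℂ] E) (p : ℕ) (H : Submodule ℂ E) : Prop where
  isClosed : IsClosed (H : Set E)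
  map_mem : ∀ f ∈ H, A f ∈ H
  pow_mem : ∀ f, (A ^ p) f ∈ H
  eq_zero : ∀ f ∈ H, A f = 0 → f = 0
  exists_preimage : ∀ g ∈ H, ∃ f ∈ H, A f = g
  finiteDimensional : FiniteDimensional ℂ (LinearMap.ker ((A ^ p : E →L[ℂ] E) : E →ₗ[ℂ] E))

namespace IsRieszComplement

variable {A : E →L[ℂ] E} {p : ℕ} {H : Submodule ℂ E}

theorem eq_zero_of_pow (h : IsRieszComplement A p H) (n : ℕ) :
    ∀ f ∈ H, (A ^ n) f = 0 → f = 0 := by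
  induction n with
  | zero => intro f _ h0; simpa using h0
  | succ n ih =>
    intro f hf h0
    rw [pow_succ] at h0
    exact h.eq_zero f hf (ih _ (h.map_mem f hf) h0)

theorem exists_preimage_pow (h : IsRieszComplement A p H) (n : ℕ) :
    ∀ g ∈ H, ∃ f ∈ H, (A ^ n) f = g := by
  induction n with
  | zero => intro g hg; exact ⟨g, hg, by simp⟩
  | succ n ih =>
    intro g hg
    obtain ⟨g', hg', rfl⟩ := ih g hg
    obtain ⟨f, hf, rfl⟩ := h.exists_preimage g' hg'
    exact ⟨f, hf, by rw [pow_succ]; rfl⟩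

theorem exists_sub_mem (h : IsRieszComplement A p H) (f : E) :
    ∃ g ∈ H, (A ^ p) (f - g) = 0 := by
  obtain ⟨g, hg, hgf⟩ := h.exists_preimage_pow p _ (h.pow_mem f)
  exact ⟨g, hg, by rw [map_sub, hgf, sub_self]⟩

end IsRieszComplement

theorem sub_smul_one_apply (T : E →L[ℂ] E) (z : ℂ) (f : E) :
    (T - z • (1 : E →L[ℂ] E)) f = T f - z • f := rfl

theorem sub_smul_one_pow_comm (T : E →L[ℂ] E) (z w : ℂ) (n : ℕ) (f : E) :
    (T - w • (1 : E →L[ℂ] E)) (((T - z • (1 : E →L[ℂ] E)) ^ n) f) =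
      ((T - z • (1 : E →L[ℂ] E)) ^ n) ((T - w • (1 : E →L[ℂ] E)) f) := by
  have h : Commute (T - w • (1 : E →L[ℂ] E)) (T - z • (1 : E →L[ℂ] E)) :=
    ((Commute.refl T).sub_left ((Commute.one_left T).smul_left w)).sub_right
      ((Commute.one_right _).smul_right z)
  exact congrArg (fun B : E →L[ℂ] E => B f) (h.pow_right n).eq

section Family

variable {T : E →L[ℂ] E} {z w : ℂ} {p : ℕ} {H : Submodule ℂ E}

/-- On `ker (T - w)` the operator `T - z` is multiplication by the nonzero scalar `w - z`. -/
theorem eq_zero_of_pow_eq_zero_of_ne (hzw : w ≠ z) (n : ℕ) :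
    ∀ k : E, ((T - z • (1 : E →L[ℂ] E)) ^ n) k = 0 →
      (T - w • (1 : E →L[ℂ] E)) k = 0 → k = 0 := by
  induction n with
  | zero => intro k h0 _; simpa using h0
  | succ n ih =>
    intro k h0 hk
    have h1 : (T - z • (1 : E →L[ℂ] E)) k = (w - z) • k := by
      rw [sub_smul_one_apply, sub_eq_zero] at hk
      rw [sub_smul_one_apply, hk, sub_smul]
    refine ih k ?_ hk
    rw [pow_succ] at h0
    change ((T - z • (1 : E →L[ℂ] E)) ^ n) ((T - z • (1 : E →L[ℂ] E)) k) = 0 at h0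
    rw [h1, map_smul] at h0
    exact (smul_eq_zero.1 h0).resolve_left (sub_ne_zero.2 hzw)

theorem IsRieszComplement.apply_mem
    (h : IsRieszComplement (T - z • (1 : E →L[ℂ] E)) p H) {f : E} (hf : f ∈ H) : T f ∈ H := by
  have h1 := H.add_mem (h.map_mem f hf) (H.smul_mem z hf)
  rwa [sub_smul_one_apply, sub_add_cancel] at h1

/-- Split `f = g + k` with `g ∈ H` and `k ∈ ker (T - z)^p`. Then `(T - w) k` lies both in `H` and in
that kernel, so it vanishes, and `w ≠ z` forces `k = 0`. -/
theorem IsRieszComplement.mem_of_sub_smul_mem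
    (h : IsRieszComplement (T - z • (1 : E →L[ℂ] E)) p H) (hzw : w ≠ z) {f : E}
    (hf : (T - w • (1 : E →L[ℂ] E)) f ∈ H) : f ∈ H := by
  obtain ⟨g, hg, hfg⟩ := h.exists_sub_mem f
  have h1 : (T - w • (1 : E →L[ℂ] E)) (f - g) ∈ H := by
    rw [map_sub]
    exact H.sub_mem hf (H.sub_mem (h.apply_mem hg) (H.smul_mem w hg))
  have h2 : (T - w • (1 : E →L[ℂ] E)) (f - g) = 0 := by
    refine h.eq_zero_of_pow p _ h1 ?_
    rw [← sub_smul_one_pow_comm, hfg, map_zero]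
  have h3 := eq_zero_of_pow_eq_zero_of_ne hzw p _ hfg h2
  rwa [sub_eq_zero.1 h3]

theorem IsRieszComplement.mem_of_pow_eq_zero
    (h : IsRieszComplement (T - z • (1 : E →L[ℂ] E)) p H) (hzw : w ≠ z) (n : ℕ) :
    ∀ f : E, ((T - w • (1 : E →L[ℂ] E)) ^ n) f = 0 → f ∈ H := by
  induction n with
  | zero => intro f hf; rw [pow_zero] at hf; rw [show f = 0 from hf]; exact H.zero_mem
  | succ n ih =>
    intro f hf
    rw [pow_succ] at hf
    exact h.mem_of_sub_smul_mem hzw (ih _ hf)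

variable {ι : Type*} {lam : ι → ℂ} {q : ι → ℕ} {K : ι → Submodule ℂ E}

/-- Each generalized kernel lies in the complements attached to the other eigenvalues. Removing from
`f` its component in the kernel of index `j` therefore does not leave the complements already
intersected. -/
theorem iSup_ker_pow_sup_iInf_eq_top (hlam : Function.Injective lam)
    (h : ∀ i, IsRieszComplement (T - lam i • (1 : E →L[ℂ] E)) (q i) (K i)) (s : Finset ι) :
    (⨆ i ∈ s, LinearMap.ker (((T - lam i • (1 : E →L[ℂ] E)) ^ q i : E →L[ℂ] E) : E →ₗ[ℂ] E)) ⊔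
      (⨅ i ∈ s, K i) = ⊤ := by
  classical
  induction s using Finset.induction_on with
  | empty => simp
  | insert j s hj ih =>
    rw [eq_top_iff, ← ih, Finset.iSup_insert, Finset.iInf_insert]
    refine sup_le (le_sup_right.trans le_sup_left) fun f hf => ?_
    obtain ⟨g, hg, hfg⟩ := (h j).exists_sub_mem f
    rw [← sub_add_cancel f g]
    refine Submodule.add_mem_sup (Submodule.mem_sup_left hfg) ⟨hg, ?_⟩
    simp only [SetLike.mem_coe, Submodule.mem_iInf] at hf ⊢
    intro i hi
    have h1 := (h i).mem_of_pow_eq_zero (hlam.ne (ne_of_mem_of_not_mem hi hj).symm) _ _ hfg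
    simpa using (K i).sub_mem (hf i hi) h1

theorem iSup_ker_pow_inf_iInf_eq_bot (hlam : Function.Injective lam)
    (h : ∀ i, IsRieszComplement (T - lam i • (1 : E →L[ℂ] E)) (q i) (K i)) (s : Finset ι) :
    (⨆ i ∈ s, LinearMap.ker (((T - lam i • (1 : E →L[ℂ] E)) ^ q i : E →L[ℂ] E) : E →ₗ[ℂ] E)) ⊓
      (⨅ i ∈ s, K i) = ⊥ := by
  classical
  induction s using Finset.induction_on with
  | empty => simp
  | insert j s hj ih =>
    rw [eq_bot_iff, ← ih, Finset.iSup_insert, Finset.iInf_insert]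
    rintro f ⟨hf, hfj, hfs⟩
    obtain ⟨k, hk, y, hy, rfl⟩ := Submodule.mem_sup.1 hf
    have hyj : y ∈ K j := by
      refine (iSup₂_le fun i hi x hx => ?_ : _ ≤ K j) hy
      exact (h j).mem_of_pow_eq_zero (hlam.ne (ne_of_mem_of_not_mem hi hj)) _ _ hx
    have hkj : k ∈ K j := by simpa using (K j).sub_mem hfj hyj
    have hk0 : k = 0 := (h j).eq_zero_of_pow _ _ hkj hk
    subst hk0
    rw [zero_add] at hfs ⊢
    exact ⟨hy, hfs⟩

theorem isInternal_spectralSummand {m : ℕ} {lam : Fin m → ℂ} {q : Fin m → ℕ}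
    {K : Fin m → Submodule ℂ E} (hlam : Function.Injective lam)
    (h : ∀ i, IsRieszComplement (T - lam i • (1 : E →L[ℂ] E)) (q i) (K i)) :
    DirectSum.IsInternal (spectralSummand T lam q (⨅ i, K i)) := by
  have htop := iSup_ker_pow_sup_iInf_eq_top hlam h Finset.univ
  have hbot := iSup_ker_pow_inf_iInf_eq_bot hlam h Finset.univ
  simp only [Finset.mem_univ, iSup_pos, iInf_pos] at htop hbot
  rw [DirectSum.isInternal_submodule_iff_iSupIndep_and_iSup_eq_top]
  constructor
  · rintro (_ | j)
    · rw [disjoint_iff, eq_bot_iff, ← hbot, inf_comm]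
      refine inf_le_inf_right _ (iSup₂_le ?_)
      rintro (_ | i) hi
      · exact absurd rfl hi
      · exact le_iSup (fun i => LinearMap.ker
          (((T - lam i • (1 : E →L[ℂ] E)) ^ q i : E →L[ℂ] E) : E →ₗ[ℂ] E)) i
    · have hle : ⨆ i, ⨆ (_ : i ≠ some j), spectralSummand T lam q (⨅ i, K i) i ≤ K j := by
        refine iSup₂_le ?_
        rintro (_ | i) hi
        · exact iInf_le _ j
        · exact fun x hx => (h j).mem_of_pow_eq_zero
            (hlam.ne fun hij => hi (congrArg some hij)) _ _ hx
      rw [Submodule.disjoint_def]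
      exact fun x hx hx' => (h j).eq_zero_of_pow _ _ (hle hx') hx
  · rw [iSup_option, sup_comm]
    exact htop

end Family

end RieszComplement

/-! ### The explicit complement for a rank-one perturbation. -/

section RankOne

variable {E : Type*} [NormedAddCommGroup E] [NormedSpace ℂ E]

/-- Used with `A = T - w`, `B = w - R`, `C = B⁻¹`. Up to nonzero factors the numbers `ψ (C^(k+1)
φ)`, `k ≥ 1`, are the derivatives at `w` of `z ↦ ψ ((z - R)⁻¹ φ)`, so the hypotheses say that `1 - ψ
((z - R)⁻¹ φ)` has a zero of order `p`. The functionals `ψ ∘ C^k`, `1 ≤ k ≤ p`, are shifted down by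
`A` up to sign, the lowest being killed; `A^p` therefore maps into their common kernel. -/
theorem isRieszComplement_of_rankOne {A B C : E →L[ℂ] E} {φ : E} {ψ : E →L[ℂ] ℂ} {p : ℕ}
    (hA : ∀ f, A f = ψ f • φ - B f) (hBC : ∀ f, B (C f) = f) (hCB : ∀ f, C (B f) = f)
    (h1 : ψ (C φ) = 1) (h2 : ∀ k, 2 ≤ k → k ≤ p → ψ ((C ^ k) φ) = 0)
    (hp : ψ ((C ^ (p + 1)) φ) ≠ 0) (hp1 : 1 ≤ p) :
    IsRieszComplement A p
      (⨅ k : Fin p, LinearMap.ker ((ψ.comp (C ^ (k + 1 : ℕ)) : E →L[ℂ] ℂ) : E →ₗ[ℂ] ℂ)) := by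
  have hmem : ∀ f, f ∈ (⨅ k : Fin p,
      LinearMap.ker ((ψ.comp (C ^ (k + 1 : ℕ)) : E →L[ℂ] ℂ) : E →ₗ[ℂ] ℂ)) ↔
      ∀ k, k < p → ψ ((C ^ (k + 1)) f) = 0 := by
    intro f
    simp only [Submodule.mem_iInf, Fin.forall_iff]
    rfl
  have hstep : ∀ k f, ψ ((C ^ (k + 1)) (A f)) =
      ψ f * ψ ((C ^ (k + 1)) φ) - ψ ((C ^ k) f) := by
    intro k f
    have : (C ^ (k + 1)) (B f) = (C ^ k) f := by
      rw [pow_succ]; exact congrArg (C ^ k) (hCB f)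
    rw [hA, map_sub, map_sub, map_smul, map_smul, smul_eq_mul, this]
  have hzero : ∀ f, ψ ((C ^ 1) (A f)) = 0 := by
    intro f
    have := hstep 0 f
    simpa [h1] using this
  have hsucc : ∀ k, 1 ≤ k → k < p → ∀ f, ψ ((C ^ (k + 1)) (A f)) = - ψ ((C ^ k) f) := by
    intro k hk hkp f
    rw [hstep, h2 (k + 1) (by omega) (by omega)]
    ring
  have hpow : ∀ n k, k < n → k < p → ∀ f, ψ ((C ^ (k + 1)) ((A ^ n) f)) = 0 := by
    intro n
    induction n with
    | zero => intro k hk; omega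
    | succ n ih =>
      intro k hk hkp f
      rw [pow_succ' A n]
      change ψ ((C ^ (k + 1)) (A ((A ^ n) f))) = 0
      rcases k with _ | k
      · exact hzero _
      · rw [hsucc (k + 1) (by omega) hkp, ih k (by omega) (by omega), neg_zero]
  -- The shift relation at level `p`, the first with a nonzero coefficient, forces `ψ f = 0`; then
  -- `A f = -B f`.
  have hinj : ∀ f, (∀ k, k < p → ψ ((C ^ (k + 1)) f) = 0) → A f = 0 → f = 0 := by
    intro f hf hAf
    have h3 := hstep p f
    obtain ⟨r, rfl⟩ : ∃ r, p = r + 1 := ⟨p - 1, by omega⟩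
    rw [hAf, map_zero, map_zero, hf r (by omega), sub_zero] at h3
    have h4 : ψ f = 0 := (mul_eq_zero.1 h3.symm).resolve_right hp
    have h5 := hA f
    rw [hAf, h4, zero_smul, zero_sub, eq_comm, neg_eq_zero] at h5
    rw [← hCB f, h5, map_zero]
  have hinj' : ∀ n f, (∀ k, k < p → ψ ((C ^ (k + 1)) f) = 0) → (A ^ n) f = 0 → f = 0 := by
    intro n
    induction n with
    | zero => intro f _ h0; simpa using h0
    | succ n ih =>
      intro f hf h0
      rw [pow_succ] at h0
      refine hinj f hf (ih _ (fun k hk => ?_) h0)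
      rcases k with _ | k
      · exact hzero f
      · rw [hsucc (k + 1) (by omega) hk, hf k (by omega), neg_zero]
  refine ⟨?_, ?_, ?_, ?_, ?_, ?_⟩
  · rw [Submodule.coe_iInf]
    exact isClosed_iInter fun k => (ψ.comp (C ^ (k + 1 : ℕ))).isClosed_ker
  · intro f hf
    rw [hmem] at hf ⊢
    rintro (_ | k) hk
    · exact hzero f
    · rw [hsucc (k + 1) (by omega) hk, hf k (by omega), neg_zero]
  · intro f
    rw [hmem]
    exact fun k hk => hpow p k hk hk f
  · intro f hf
    exact hinj f ((hmem f).1 hf)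
  · intro g hg
    rw [hmem] at hg
    -- A preimage must be `C (t • φ - g)` with `t` its value under `ψ`. This `t` makes the top
    -- functional `ψ ∘ C^p` vanish on it; the lower ones vanish for any `t`.
    set t : ℂ := ψ ((C ^ (p + 1)) g) / ψ ((C ^ (p + 1)) φ) with ht
    have hC : ∀ k, ψ ((C ^ k) (C (t • φ - g))) =
        t * ψ ((C ^ (k + 1)) φ) - ψ ((C ^ (k + 1)) g) := by
      intro k
      have : (C ^ k) (C (t • φ - g)) = (C ^ (k + 1)) (t • φ - g) := by rw [pow_succ]; rfl
      rw [this, map_sub, map_sub, map_smul, map_smul, smul_eq_mul]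
    refine ⟨C (t • φ - g), (hmem _).2 fun k hk => ?_, ?_⟩
    · rw [hC]
      rcases Nat.lt_or_ge (k + 1) p with hkp | hkp
      · rw [hg _ hkp, h2 (k + 1 + 1) (by omega) (by omega)]
        ring
      · obtain rfl : p = k + 1 := by omega
        rw [ht, div_mul_cancel₀ _ hp, sub_self]
    · have h3 : ψ (C (t • φ - g)) = t := by
        have h4 := hC 0
        have h5 := hg 0 hp1
        simp only [zero_add, pow_one, pow_zero, one_apply_eq_self] at h4 h5
        rw [h4, h5, h1]; ring
      rw [hA, hBC, h3, sub_sub_cancel]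
  -- The `p` functionals jointly separate points of `ker (A^p)`, so its dimension is at most `p`.
  · let Φ : E →ₗ[ℂ] (Fin p → ℂ) :=
      LinearMap.pi fun k => ((ψ.comp (C ^ (k + 1 : ℕ)) : E →L[ℂ] ℂ) : E →ₗ[ℂ] ℂ)
    refine FiniteDimensional.of_injective (Φ.comp (Submodule.subtype _)) ?_
    rw [← LinearMap.ker_eq_bot, LinearMap.ker_eq_bot']
    rintro ⟨f, hf⟩ hΦ
    refine Subtype.ext (hinj' p f (fun k hk => ?_) hf)
    exact congrFun hΦ ⟨k, hk⟩

end RankOne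

open Filter Topology

/-! ### Resolvents, zeros of the characteristic function, and the splitting. -/

section Resolvent

variable {E : Type*} [NormedAddCommGroup E] [NormedSpace ℂ E]

theorem sub_apply_resolvent {R : E →L[ℂ] E} {z : ℂ} (hz : z ∈ resolventSet ℂ R) (f : E) :
    (algebraMap ℂ (E →L[ℂ] E) z - R) (resolvent R z f) = f :=
  congrArg (fun B : E →L[ℂ] E => B f)
    (Ring.mul_inverse_cancel (algebraMap ℂ (E →L[ℂ] E) z - R) hz)

theorem resolvent_sub_apply {R : E →L[ℂ] E} {z : ℂ} (hz : z ∈ resolventSet ℂ R) (f : E) :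
    resolvent R z ((algebraMap ℂ (E →L[ℂ] E) z - R) f) = f :=
  congrArg (fun B : E →L[ℂ] E => B f)
    (Ring.inverse_mul_cancel (algebraMap ℂ (E →L[ℂ] E) z - R) hz)

theorem algebraMap_sub_apply (R : E →L[ℂ] E) (z : ℂ) (f : E) :
    (algebraMap ℂ (E →L[ℂ] E) z - R) f = z • f - R f := rfl

theorem mem_resolventSet_of_norm_pow_le [CompleteSpace E] {R : E →L[ℂ] E} {C β : ℝ}
    (hβ : 0 ≤ β) (h : ∀ n : ℕ, ‖R ^ n‖ ≤ C * β ^ n) {z : ℂ} (hz : β < ‖z‖) :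
    z ∈ resolventSet ℂ R := by
  by_contra hmem
  have hspec : z ∈ spectrum ℂ R := hmem
  have hbound : ∀ n : ℕ, ‖z‖ ^ n ≤ C * ‖(1 : E →L[ℂ] E)‖ * β ^ n := by
    intro n
    have h1 := spectrum.norm_le_norm_mul_of_mem (spectrum.pow_mem_pow R n hspec)
    rw [norm_pow] at h1
    have h2 := mul_le_mul_of_nonneg_right (h n) (norm_nonneg (1 : E →L[ℂ] E))
    linarith [mul_right_comm C (β ^ n) ‖(1 : E →L[ℂ] E)‖]
  have hz0 : 0 < ‖z‖ := hβ.trans_lt hz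
  have hlim : Tendsto (fun n : ℕ => C * ‖(1 : E →L[ℂ] E)‖ * (β / ‖z‖) ^ n) atTop (𝓝 0) := by
    simpa using (tendsto_pow_atTop_nhds_zero_of_lt_one (div_nonneg hβ hz0.le)
      ((div_lt_one hz0).2 hz)).const_mul (C * ‖(1 : E →L[ℂ] E)‖)
  have : (1 : ℝ) ≤ 0 := by
    refine ge_of_tendsto' hlim fun n => ?_
    rw [div_pow, ← mul_div_assoc, le_div_iff₀ (pow_pos hz0 n), one_mul]
    exact hbound n
  linarith

/-- If all Taylor coefficients of `z ↦ ψ ((z - R)⁻¹ φ) - 1` at `w` vanish, so does the function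
near `w`. -/
theorem eventually_apply_resolvent_eq_one [CompleteSpace E] {R : E →L[ℂ] E} {w : ℂ}
    (hw : w ∈ resolventSet ℂ R) {φ : E} {ψ : E →L[ℂ] ℂ} (h1 : ψ (resolvent R w φ) = 1)
    (h2 : ∀ k, 2 ≤ k → ψ ((resolvent R w ^ k) φ) = 0) :
    ∀ᶠ z in 𝓝 w, ψ (resolvent R z φ) = 1 := by
  set C := resolvent R w with hC
  have hsmall : ∀ᶠ z in 𝓝 w, ‖w - z‖ * ‖C‖ < 1 := by
    have hc : Continuous fun z : ℂ => ‖w - z‖ * ‖C‖ := by fun_prop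
    have := hc.tendsto w
    simp only [sub_self, norm_zero, zero_mul] at this
    exact this.eventually (gt_mem_nhds one_pos)
  filter_upwards [hsmall, (spectrum.isOpen_resolventSet (𝕜 := ℂ) R).mem_nhds hw] with z hz hzR
  set v := resolvent R z φ with hv
  have hvz : z • v - R v = φ := sub_apply_resolvent hzR φ
  have hrec : v = C φ + (w - z) • C v := by
    have h3 : (algebraMap ℂ (E →L[ℂ] E) w - R) v = φ + (w - z) • v := by
      rw [algebraMap_sub_apply, ← hvz, sub_smul]; abel
    rw [← map_smul, ← map_add, ← h3, hC, resolvent_sub_apply hw v]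
  -- Iterated resolvent identity: every intermediate term vanishes by `h2`, and the remainder tends
  -- to zero since `‖w - z‖ ‖C‖ < 1`.
  have hiter : ∀ n : ℕ, ψ v = 1 + (w - z) ^ (n + 1) * ψ ((C ^ (n + 1)) v) := by
    intro n
    induction n with
    | zero =>
      conv_lhs => rw [hrec]
      simp [h1]
    | succ n ih =>
      have h3 : (C ^ (n + 1)) v = (C ^ (n + 2)) φ + (w - z) • (C ^ (n + 2)) v := by
        conv_lhs => rw [hrec]
        rw [map_add, map_smul, pow_succ C (n + 1)]
        rfl
      rw [ih, h3, map_add, h2 _ (by omega), map_smul, smul_eq_mul]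
      ring
  have hlim : Tendsto (fun n : ℕ => ‖ψ‖ * ((‖w - z‖ * ‖C‖) ^ (n + 1) * ‖v‖)) atTop (𝓝 0) := by
    have := (tendsto_pow_atTop_nhds_zero_of_lt_one (by positivity) hz).comp
      (tendsto_add_atTop_nat 1)
    simpa using (this.mul_const ‖v‖).const_mul ‖ψ‖
  have hle : ‖ψ v - 1‖ ≤ 0 := by
    refine ge_of_tendsto' hlim fun n => ?_
    rw [hiter n, add_sub_cancel_left, norm_mul, norm_pow, mul_pow]
    calc ‖w - z‖ ^ (n + 1) * ‖ψ ((C ^ (n + 1)) v)‖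
        ≤ ‖w - z‖ ^ (n + 1) * (‖ψ‖ * (‖C‖ ^ (n + 1) * ‖v‖)) := by
          gcongr
          refine (ψ.le_opNorm _).trans ?_
          gcongr
          refine ((C ^ (n + 1)).le_opNorm v).trans ?_
          gcongr
          exact norm_pow_le' C n.succ_pos
      _ = _ := by ring
  exact sub_eq_zero.1 (norm_le_zero_iff.1 hle)

theorem isPreconnected_setOf_lt_norm {β : ℝ} (hβ : 0 < β) :
    IsPreconnected {z : ℂ | β < ‖z‖} := by
  have : {z : ℂ | β < ‖z‖} = Complex.exp '' {z : ℂ | Real.log β < z.re} := by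
    ext z
    constructor
    · intro hz
      have hz0 : z ≠ 0 := norm_pos_iff.1 (hβ.trans hz)
      exact ⟨Complex.log z, by
        simpa [Complex.log_re] using Real.log_lt_log hβ hz, Complex.exp_log hz0⟩
    · rintro ⟨w, hw, rfl⟩
      change β < ‖Complex.exp w‖
      rw [Complex.norm_exp]
      exact (Real.log_lt_iff_lt_exp hβ).1 hw
  rw [this]
  exact (convex_halfSpace_re_gt _).isPreconnected.image _ Complex.continuous_exp.continuousOn

/-- The identity theorem on the connected exterior `|z| > β`. -/
theorem not_frequently_apply_resolvent_eq_one [CompleteSpace E] {R : E →L[ℂ] E} {β : ℝ}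
    (hβ : 0 < β) (hR : ∀ z : ℂ, β < ‖z‖ → z ∈ resolventSet ℂ R) {φ : E} {ψ : E →L[ℂ] ℂ}
    {z₀ : ℂ} (hz₀ : β < ‖z₀‖) (hψ : ψ (resolvent R z₀ φ) ≠ 1) {w : ℂ} (hw : β < ‖w‖) :
    ¬ ∃ᶠ z in 𝓝[≠] w, ψ (resolvent R z φ) = 1 := by
  intro hfreq
  have hopen : IsOpen {z : ℂ | β < ‖z‖} := isOpen_lt continuous_const continuous_norm
  have hdiff : DifferentiableOn ℂ (fun z => ψ (resolvent R z φ) - 1) {z : ℂ | β < ‖z‖} := by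
    intro z hz
    have h1 := (spectrum.hasDerivAt_resolvent_const_left (hR z hz)).differentiableAt
    have h2 : DifferentiableAt ℂ (fun z => ψ (resolvent R z φ)) z :=
      ψ.differentiableAt.comp z (h1.clm_apply (differentiableAt_const φ))
    exact (h2.sub_const 1).differentiableWithinAt
  have hzero := (hdiff.analyticOnNhd hopen).eqOn_zero_of_preconnected_of_frequently_eq_zero
    (isPreconnected_setOf_lt_norm hβ) hw (hfreq.mono fun z hz => by rw [hz, sub_self])
  exact hψ (sub_eq_zero.1 (hzero hz₀))

/-- On the Banach space `H` a bijective bounded operator is invertible, so the spectrum of the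
restriction lies in `|z| < r`. It is compact, so the spectral radius is strictly below `r`, and
Gelfand's formula supplies a suitable `n`. -/
theorem iInf_norm_pow_comp_subtypeL_lt [CompleteSpace E] {T : E →L[ℂ] E} {H : Submodule ℂ E}
    (hH : IsClosed (H : Set E)) (hT : ∀ h ∈ H, T h ∈ H) {r : ℝ} (hr : 0 < r)
    (hinj : ∀ z : ℂ, r ≤ ‖z‖ → ∀ h ∈ H, T h = z • h → h = 0)
    (hsurj : ∀ z : ℂ, r ≤ ‖z‖ → ∀ g ∈ H, ∃ h ∈ H, T h - z • h = g) :
    (⨅ n : ℕ+, ‖(T ^ (n : ℕ)).comp H.subtypeL‖ ^ (1 / ((n : ℕ) : ℝ))) < r := by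
  have : CompleteSpace H := hH.completeSpace_coe
  let S : H →L[ℂ] H := (T.comp H.subtypeL).codRestrict H fun h => hT h h.2
  have hS : ∀ (n : ℕ) (h : H), (((S ^ n) h : H) : E) = (T ^ n) h := by
    intro n
    induction n with
    | zero => intro h; rfl
    | succ n ih =>
      intro h
      rw [pow_succ, pow_succ]
      exact ih (S h)
  have hle : ∀ n : ℕ, ‖(T ^ n).comp H.subtypeL‖ ≤ ‖S ^ n‖ := by
    intro n
    refine ContinuousLinearMap.opNorm_le_bound _ (S ^ n).opNorm_nonneg fun h => ?_
    change ‖(T ^ n) (h : E)‖ ≤ _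
    rw [← hS]
    exact (S ^ n).le_opNorm h
  have hbdd : BddBelow (Set.range fun n : ℕ+ =>
      ‖(T ^ (n : ℕ)).comp H.subtypeL‖ ^ (1 / ((n : ℕ) : ℝ))) := by
    refine ⟨0, ?_⟩
    rintro _ ⟨n, rfl⟩
    positivity
  have hrad : spectralRadius ℂ S < (r.toNNReal : ℝ≥0∞) := by
    -- The case `H = 0` has empty spectrum and is treated apart.
    rcases subsingleton_or_nontrivial H with hsub | hnon
    · rw [spectrum.SpectralRadius.of_subsingleton]
      simpa using hr
    · refine spectrum.spectralRadius_lt_of_forall_lt S fun z hz => ?_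
      by_contra hrz
      have hrz' : r ≤ ‖z‖ := by
        have := not_lt.1 hrz
        rwa [Real.toNNReal_le_iff_le_coe, coe_nnnorm] at this
      refine hz ?_
      rw [spectrum.mem_resolventSet_iff, ← IsUnit.neg_iff,
        ContinuousLinearMap.isUnit_iff_bijective]
      have hval : ∀ h : H, (((-(algebraMap ℂ (H →L[ℂ] H) z - S)) h : H) : E) =
          T h - z • (h : E) := by
        intro h
        rw [neg_sub]
        rfl
      constructor
      · rw [injective_iff_map_eq_zero]
        intro h hh
        have h1 := hval h
        rw [hh] at h1
        exact Subtype.ext (hinj z hrz' h h.2 (sub_eq_zero.1 h1.symm))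
      · intro g
        obtain ⟨h, hh, hg⟩ := hsurj z hrz' g g.2
        exact ⟨⟨h, hh⟩, Subtype.ext ((hval ⟨h, hh⟩).trans hg)⟩
  have hev := (spectrum.pow_nnnorm_pow_one_div_tendsto_nhds_spectralRadius S).eventually
    (gt_mem_nhds hrad)
  obtain ⟨n, hn, hn1⟩ := (hev.and (eventually_ge_atTop 1)).exists
  refine (ciInf_le hbdd ⟨n, hn1⟩).trans_lt ?_
  rw [← ENNReal.coe_rpow_of_nonneg _ (by positivity), ENNReal.coe_lt_coe,
    Real.lt_toNNReal_iff_coe_lt, NNReal.coe_rpow, coe_nnnorm] at hn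
  refine lt_of_le_of_lt ?_ hn
  exact Real.rpow_le_rpow (ContinuousLinearMap.opNorm_nonneg _) (hle n) (by positivity)

/-- A rank-one perturbation of an operator of spectral radius at most `β < r` splits at `r`. -/
theorem hasSpectralSplitting_of_rankOne [CompleteSpace E] {T R : E →L[ℂ] E} {φ : E}
    {ψ : E →L[ℂ] ℂ} (hTR : ∀ f, T f = R f + ψ f • φ) {β r : ℝ} (hβ : 0 < β) (hβr : β < r)
    (hr : r < 1) (hR : ∀ z : ℂ, β < ‖z‖ → z ∈ resolventSet ℂ R)
    (hT : ∀ z : ℂ, 1 < ‖z‖ → z ∈ resolventSet ℂ T) {e : E} (he : e ≠ 0) (hTe : T e = e) :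
    HasSpectralSplitting T r := by
  have heig : ∀ z : ℂ, β < ‖z‖ → ψ (resolvent R z φ) = 1 →
      T (resolvent R z φ) = z • resolvent R z φ := by
    intro z hz h1
    have h2 := sub_apply_resolvent (hR z hz) φ
    rw [algebraMap_sub_apply] at h2
    rw [hTR, h1, one_smul, ← sub_eq_iff_eq_add'.1 h2]
  have hle1 : ∀ z : ℂ, β < ‖z‖ → ψ (resolvent R z φ) = 1 → ‖z‖ ≤ 1 := by
    intro z hz h1
    by_contra hz1
    have h2 := resolvent_sub_apply (hT z (not_le.1 hz1)) (resolvent R z φ)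
    rw [algebraMap_sub_apply, heig z hz h1, sub_self, map_zero] at h2
    rw [← h2, map_zero] at h1
    exact zero_ne_one h1
  have hnf : ∀ w : ℂ, β < ‖w‖ → ¬ ∃ᶠ z in 𝓝[≠] w, ψ (resolvent R z φ) = 1 := by
    intro w hw
    -- Any point outside the closed unit disc would serve as `z₀`.
    refine not_frequently_apply_resolvent_eq_one hβ hR (z₀ := 2) ?_ (fun h => ?_) hw
    · rw [Complex.norm_ofNat]; linarith
    · have := hle1 2 (by rw [Complex.norm_ofNat]; linarith) h
      rw [Complex.norm_ofNat] at this
      linarith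
  set Z : Set ℂ := {z | r ≤ ‖z‖ ∧ ψ (resolvent R z φ) = 1} with hZdef
  have hZfin : Z.Finite := by
    by_contra hinf
    have hsub : Z ⊆ Metric.closedBall 0 1 ∩ {z | r ≤ ‖z‖} := fun z hz =>
      ⟨mem_closedBall_zero_iff.2 (hle1 z (hβr.trans_le hz.1) hz.2), hz.1⟩
    have hK : IsCompact (Metric.closedBall (0 : ℂ) 1 ∩ {z | r ≤ ‖z‖}) :=
      (isCompact_closedBall 0 1).inter_right (isClosed_le continuous_const continuous_norm)
    obtain ⟨w, hwK, hw⟩ := Set.Infinite.exists_accPt_of_subset_isCompact hinf hK hsub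
    exact hnf w (hβr.trans_le hwK.2)
      ((accPt_iff_frequently_nhdsNE.1 hw).mono fun z hz => hz.2)
  have hord : ∀ w ∈ Z, ∃ p : ℕ, 1 ≤ p ∧
      (∀ k, 2 ≤ k → k ≤ p → ψ ((resolvent R w ^ k) φ) = 0) ∧
      ψ ((resolvent R w ^ (p + 1)) φ) ≠ 0 := by
    intro w hw
    have hwβ := hβr.trans_le hw.1
    -- A zero of infinite order would make the function constant near `w`.
    have hex : ∃ p : ℕ, 1 ≤ p ∧ ψ ((resolvent R w ^ (p + 1)) φ) ≠ 0 := by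
      by_contra! hall
      refine hnf w hwβ (Eventually.frequently ?_)
      refine (eventually_apply_resolvent_eq_one (hR w hwβ) hw.2 fun k hk => ?_).filter_mono
        nhdsWithin_le_nhds
      obtain ⟨j, rfl⟩ : ∃ j, k = j + 1 := ⟨k - 1, by omega⟩
      exact hall j (by omega)
    classical
    refine ⟨Nat.find hex, (Nat.find_spec hex).1, fun k hk hkp => ?_, (Nat.find_spec hex).2⟩
    have hmin := Nat.find_min hex (m := k - 1) (by omega)
    rw [not_and, not_not] at hmin
    have h3 := hmin (by omega)
    rwa [Nat.sub_add_cancel (by omega)] at h3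
  have hA : ∀ (w : ℂ) (f : E), (T - w • (1 : E →L[ℂ] E)) f =
      ψ f • φ - (algebraMap ℂ (E →L[ℂ] E) w - R) f := by
    intro w f
    rw [sub_smul_one_apply, algebraMap_sub_apply, hTR]
    abel
  have hcompl : ∀ w ∈ Z, ∃ p : ℕ, 1 ≤ p ∧ ∃ K : Submodule ℂ E,
      IsRieszComplement (T - w • (1 : E →L[ℂ] E)) p K := by
    intro w hw
    obtain ⟨p, hp1, h2, hp⟩ := hord w hw
    have hwR := hR w (hβr.trans_le hw.1)
    exact ⟨p, hp1, _, isRieszComplement_of_rankOne (hA w) (sub_apply_resolvent hwR)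
      (resolvent_sub_apply hwR) hw.2 h2 hp hp1⟩
  choose! q hq1 K hK using hcompl
  obtain ⟨m, lam, hlam, hrange⟩ : ∃ (m : ℕ) (lam : Fin m → ℂ), Function.Injective lam ∧
      Set.range lam = Z := by
    have : Finite Z := hZfin
    obtain ⟨m, ⟨en⟩⟩ := Finite.exists_equiv_fin Z
    exact ⟨m, fun i => (en.symm i : ℂ), Subtype.val_injective.comp en.symm.injective, by
      rw [Set.range_comp' Subtype.val en.symm, en.symm.surjective.range_eq, Set.image_univ,
        Subtype.range_coe]⟩
  have hmemZ : ∀ i, lam i ∈ Z := fun i => hrange ▸ Set.mem_range_self i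
  have hall : ∀ i, IsRieszComplement (T - lam i • (1 : E →L[ℂ] E)) (q (lam i)) (K (lam i)) :=
    fun i => hK _ (hmemZ i)
  -- The fixed vector satisfies `e = ψ e • (1 - R)⁻¹ φ`, with `ψ e ≠ 0` because `e ≠ 0`. This is
  -- what ensures at least one eigenvalue, `1 ≤ m`.
  have honeZ : (1 : ℂ) ∈ Z := by
    have hn : β < ‖(1 : ℂ)‖ := by rw [norm_one]; linarith
    refine ⟨by rw [norm_one]; exact hr.le, ?_⟩
    have h1 : (algebraMap ℂ (E →L[ℂ] E) 1 - R) e = ψ e • φ := by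
      rw [algebraMap_sub_apply, one_smul, sub_eq_iff_eq_add', ← hTR, hTe]
    have h2 := resolvent_sub_apply (hR 1 hn) e
    rw [h1, map_smul] at h2
    have h3 : ψ e ≠ 0 := by
      intro h0
      rw [h0, zero_smul] at h2
      exact he h2.symm
    have h4 := congrArg ψ h2
    rw [map_smul, smul_eq_mul] at h4
    exact mul_left_cancel₀ h3 (h4.trans (mul_one _).symm)
  obtain ⟨i₀, -⟩ : ∃ i, lam i = 1 := by rwa [← hrange] at honeZ
  refine ⟨m, lam, fun i => q (lam i), ⨅ i, K (lam i), i₀.pos, fun i => hq1 _ (hmemZ i),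
    isInternal_spectralSummand hlam hall,
    fun i => ⟨(hmemZ i).1, fun hbot => ?_, (hall i).finiteDimensional⟩, ?_, ?_, ?_⟩
  · have hwβ := hβr.trans_le (hmemZ i).1
    have h1 : resolvent R (lam i) φ ∈ spectralSummand T lam (fun i => q (lam i))
        (⨅ i, K (lam i)) (some i) := by
      change ((T - lam i • (1 : E →L[ℂ] E)) ^ q (lam i)) (resolvent R (lam i) φ) = 0
      obtain ⟨j, hj⟩ : ∃ j, q (lam i) = j + 1 :=
        ⟨q (lam i) - 1, by have := hq1 _ (hmemZ i); omega⟩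
      rw [hj, pow_succ]
      change ((T - lam i • (1 : E →L[ℂ] E)) ^ j)
        ((T - lam i • (1 : E →L[ℂ] E)) (resolvent R (lam i) φ)) = 0
      rw [sub_smul_one_apply, heig _ hwβ (hmemZ i).2, sub_self, map_zero]
    rw [hbot, Submodule.mem_bot] at h1
    have h2 := (hmemZ i).2
    rw [h1, map_zero] at h2
    exact zero_ne_one h2
  · rw [Submodule.coe_iInf]
    exact isClosed_iInter fun i => (hall i).isClosed
  · intro h hh
    rw [Submodule.mem_iInf] at hh ⊢
    exact fun i => (hall i).apply_mem (hh i)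
  -- Solutions of `(T - z) f = g` with `g ∈ H` lie automatically in every complement except possibly
  -- the one attached to `z` itself.
  · have hmem : ∀ (z : ℂ) (f : E), (∀ i, lam i = z → f ∈ K (lam i)) →
        (∀ i, (T - z • (1 : E →L[ℂ] E)) f ∈ K (lam i)) → f ∈ ⨅ i, K (lam i) := by
      intro z f h1 h2
      rw [Submodule.mem_iInf]
      intro i
      by_cases hi : lam i = z
      · exact h1 i hi
      · exact (hall i).mem_of_sub_smul_mem (Ne.symm hi) (h2 i)
    have hone : ∀ z : ℂ, r ≤ ‖z‖ → ψ (resolvent R z φ) = 1 → ∃ i, lam i = z := by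
      intro z hz h1
      have : z ∈ Z := ⟨hz, h1⟩
      rwa [← hrange] at this
    refine iInf_norm_pow_comp_subtypeL_lt ?_ ?_ (hβ.trans hβr) ?_ ?_
    · rw [Submodule.coe_iInf]
      exact isClosed_iInter fun i => (hall i).isClosed
    · intro h hh
      rw [Submodule.mem_iInf] at hh ⊢
      exact fun i => (hall i).apply_mem (hh i)
    · intro z hz h hh hTh
      rw [Submodule.mem_iInf] at hh
      by_cases h1 : ψ (resolvent R z φ) = 1
      · obtain ⟨i, rfl⟩ := hone z hz h1
        exact (hall i).eq_zero h (hh i) (by rw [sub_smul_one_apply, hTh, sub_self])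
      · have h2 : (algebraMap ℂ (E →L[ℂ] E) z - R) h = ψ h • φ := by
          rw [algebraMap_sub_apply, ← hTh, hTR, add_sub_cancel_left]
        have h3 := resolvent_sub_apply (hR z (hβr.trans_le hz)) h
        rw [h2, map_smul] at h3
        have h4 := congrArg ψ h3
        rw [map_smul, smul_eq_mul] at h4
        have h5 : ψ h = 0 := by
          by_contra h0
          exact h1 (mul_left_cancel₀ h0 (h4.trans (mul_one _).symm))
        rw [← h3, h5, zero_smul]
    · intro z hz g hg
      have hg' := hg
      rw [Submodule.mem_iInf] at hg'
      by_cases h1 : ψ (resolvent R z φ) = 1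
      · obtain ⟨i, rfl⟩ := hone z hz h1
        obtain ⟨f, hf, hfg⟩ := (hall i).exists_preimage g (hg' i)
        refine ⟨f, hmem (lam i) f (fun j hj => ?_) (fun j => hfg ▸ hg' j), hfg⟩
        rwa [hj]
      · have hz' := hR z (hβr.trans_le hz)
        have h2 : 1 - ψ (resolvent R z φ) ≠ 0 := sub_ne_zero.2 (Ne.symm h1)
        -- Rank-one inversion: `t` solves the consistency equation `ψ f = t` for `f = (z - R)⁻¹ (t •
        -- φ - g)`.
        set t : ℂ := -ψ (resolvent R z g) / (1 - ψ (resolvent R z φ)) with ht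
        set f := resolvent R z (t • φ - g) with hf
        have h3 : ψ f = t := by
          rw [hf, map_sub, map_sub, map_smul, map_smul, smul_eq_mul, ht]
          field_simp
          ring
        have h4 : (T - z • (1 : E →L[ℂ] E)) f = g := by
          rw [hA, h3, hf, sub_apply_resolvent hz', sub_sub_cancel]
        refine ⟨f, hmem z f (fun i hi => absurd ?_ h1) (fun i => h4 ▸ hg' i), h4⟩
        rw [← hi]
        exact (hmemZ i).2

end Resolvent

/-! ### Drift and minorization estimates for the kernel and its residual. -/

section Kernel

variable {X : Type*} [MeasurableSpace X] {V : Weight X} {P : Kernel X X} {S : Set X}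
  {ν : Measure X} {δ L : ℝ}

/-- The indicator function of a measurable set, as an element of `𝓑₁`. -/
noncomputable def indicatorOne (V : Weight X) {A : Set X} (hA : MeasurableSet A) :
    WeightedSup V :=
  (⟨A.indicator fun _ => 1, measurable_const.indicator hA, 1, by
    rintro _ ⟨x, rfl⟩
    have h1 : ‖A.indicator (fun _ => (1 : ℂ)) x‖ ≤ 1 := by
      by_cases hx : x ∈ A <;> simp [hx]
    exact mul_le_one₀ h1 (inv_nonneg.2 (V.pos x).le)
      (inv_le_one_of_one_le₀ (V.one_le_toFun x))⟩ : ↥(weightedSubmodule V))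

theorem indicatorOne_apply {A : Set X} (hA : MeasurableSet A) (x : X) :
    indicatorOne V hA x = A.indicator (fun _ => (1 : ℂ)) x := rfl

theorem integrable_of_integrable_weight {μ : Measure X} (hV : Integrable V.toFun μ)
    (f : WeightedSup V) : Integrable (f : X → ℂ) μ :=
  (hV.const_mul ‖f‖).mono' f.measurable.aestronglyMeasurable
    (Eventually.of_forall fun y => WeightedSup.norm_apply_le f y)

/-- Integration against a measure for which `V` is integrable, as a functional on `𝓑₁`. -/
noncomputable def integralCLM {μ : Measure X} (hV : Integrable V.toFun μ) :
    WeightedSup V →L[ℂ] ℂ :=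
  LinearMap.mkContinuous
    { toFun := fun f => ∫ y, f y ∂μ
      map_add' := fun f g => integral_add (integrable_of_integrable_weight hV f)
        (integrable_of_integrable_weight hV g)
      map_smul' := fun c f => integral_const_mul c (fun y => f y) }
    (∫ y, V y ∂μ) fun f => by
      have h1 : ‖∫ y, f y ∂μ‖ ≤ ∫ y, ‖f‖ * V y ∂μ :=
        norm_integral_le_of_norm_le (hV.const_mul _)
          (Eventually.of_forall fun y => WeightedSup.norm_apply_le f y)
      rwa [integral_const_mul, mul_comm] at h1

theorem norm_integral_le_affine {μ : Measure X} [IsFiniteMeasure μ]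
    (hV : Integrable V.toFun μ) (f : WeightedSup V) {s c : ℝ}
    (hf : ∀ x, ‖f x‖ ≤ s * V x + c) :
    ‖∫ y, f y ∂μ‖ ≤ s * ∫ y, V y ∂μ + c * μ.real Set.univ := by
  have h1 : ‖∫ y, f y ∂μ‖ ≤ ∫ y, (s * V y + c) ∂μ :=
    norm_integral_le_of_norm_le ((hV.const_mul s).add (integrable_const c))
      (Eventually.of_forall hf)
  rw [integral_add (hV.const_mul s) (integrable_const c), integral_const_mul, integral_const,
    smul_eq_mul, mul_comm (μ.real Set.univ)] at h1
  exact h1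

theorem Drift.integral_le (h : Drift V P S δ L) (hδ : 0 < δ) (hL : 0 < L) (x : X) :
    ∫ y, V y ∂(P x) ≤ δ * V x + L * S.indicator (fun _ => (1 : ℝ)) x := by
  rw [integral_eq_lintegral_of_nonneg_ae (Eventually.of_forall fun y => (V.pos y).le)
    V.measurable_toFun.aestronglyMeasurable]
  have h1 : 0 ≤ S.indicator (fun _ => (1 : ℝ)) x := Set.indicator_nonneg (fun _ _ => zero_le_one) x
  have h2 := V.pos x
  exact ENNReal.toReal_le_of_le_ofReal (by positivity) (h x)

theorem kernelOp_indicatorOne_univ [IsMarkovKernel P] (h : WeightBounded V P) :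
    kernelOp V P h (indicatorOne V MeasurableSet.univ) = indicatorOne V MeasurableSet.univ := by
  refine WeightedSup.ext fun x => ?_
  rw [kernelOp_apply]
  simp [indicatorOne_apply]

theorem indicatorOne_univ_ne_zero [Nonempty X] :
    indicatorOne V (MeasurableSet.univ : MeasurableSet (Set.univ : Set X)) ≠ 0 := by
  intro h
  have h1 := congrArg (fun f : WeightedSup V => f (Classical.arbitrary X)) h
  simp [indicatorOne_apply] at h1

/-- With `S` empty, `P` would contract by `δ < 1`, yet it fixes the nonzero function `1`. -/
theorem Drift.nonempty [Nonempty X] [IsMarkovKernel P] (h : Drift V P S δ L) (hδ₀ : 0 < δ)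
    (hδ₁ : δ < 1) (hL : 0 < L) : S.Nonempty := by
  by_contra hS
  rw [Set.not_nonempty_iff_eq_empty] at hS
  subst hS
  have h1 : ‖kernelOp V P (h.weightBounded hδ₀ hL) (indicatorOne V MeasurableSet.univ)‖ ≤
      δ * ‖indicatorOne V (MeasurableSet.univ : MeasurableSet (Set.univ : Set X))‖ :=
    WeightedSup.norm_le_of_forall (mul_nonneg hδ₀.le (norm_nonneg _)) fun x =>
      norm_integral_le_of_bound hδ₀.le (fun x => by simpa using h x) _ x
  rw [kernelOp_indicatorOne_univ] at h1
  have h2 := norm_pos_iff.2 (indicatorOne_univ_ne_zero (V := V))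
  nlinarith

theorem Minorization.le (h : Minorization P S ν) {x : X} (hx : x ∈ S) : ν ≤ P x :=
  Measure.le_iff.2 fun A hA => by simpa [hx] using h x A hA

theorem norm_kernelOp_pow_apply_le [IsMarkovKernel P] (h : Drift V P S δ L) (hδ₀ : 0 < δ)
    (hδ₁ : δ < 1) (hL : 0 < L) (f : WeightedSup V) (n : ℕ) : ∀ x,
    ‖(kernelOp V P (h.weightBounded hδ₀ hL) ^ n) f x‖ ≤
      ‖f‖ * δ ^ n * V x + ‖f‖ * (L / (1 - δ)) * (1 - δ ^ n) := by
  induction n with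
  | zero => intro x; simpa using WeightedSup.norm_apply_le f x
  | succ n ih =>
    intro x
    rw [pow_succ']
    refine (norm_integral_le_affine ((h.weightBounded hδ₀ hL).integrable_weight x) _ ih).trans ?_
    rw [probReal_univ, mul_one]
    have h1 : ∫ y, V y ∂(P x) ≤ δ * V x + L := by
      refine (h.integral_le hδ₀ hL x).trans ?_
      have : S.indicator (fun _ => (1 : ℝ)) x ≤ 1 :=
        Set.indicator_le_self' (fun _ _ => zero_le_one) x
      have := mul_le_mul_of_nonneg_left this hL.le
      linarith
    have h2 : 0 ≤ ‖f‖ * δ ^ n := mul_nonneg (norm_nonneg f) (pow_nonneg hδ₀.le n)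
    have h3 := mul_le_mul_of_nonneg_left h1 h2
    have h4 : ‖f‖ * δ ^ n * L + ‖f‖ * (L / (1 - δ)) * (1 - δ ^ n) =
        ‖f‖ * (L / (1 - δ)) * (1 - δ ^ (n + 1)) := by
      have : (1 - δ) ≠ 0 := by linarith
      field_simp
      ring
    rw [pow_succ] at h4 ⊢
    linarith

theorem powerBounded_kernelOp [IsMarkovKernel P] (h : Drift V P S δ L) (hδ₀ : 0 < δ)
    (hδ₁ : δ < 1) (hL : 0 < L) : PowerBounded (kernelOp V P (h.weightBounded hδ₀ hL)) := by
  have hb : 0 ≤ L / (1 - δ) := div_nonneg hL.le (by linarith)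
  refine ⟨1 + L / (1 - δ), fun n => ContinuousLinearMap.opNorm_le_bound _ (by linarith)
    fun f => WeightedSup.norm_le_of_forall (by positivity) fun x => ?_⟩
  refine (norm_kernelOp_pow_apply_le h hδ₀ hδ₁ hL f n x).trans ?_
  have h1 : δ ^ n ≤ 1 := pow_le_one₀ hδ₀.le hδ₁.le
  have h2 : 0 ≤ δ ^ n := pow_nonneg hδ₀.le n
  have h3 := V.one_le_toFun x
  calc ‖f‖ * δ ^ n * V x + ‖f‖ * (L / (1 - δ)) * (1 - δ ^ n)
      ≤ ‖f‖ * 1 * V x + ‖f‖ * (L / (1 - δ)) * V x := by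
        gcongr
        linarith
    _ = _ := by ring

/-- The residual kernel `P(x, ·) - 1_S(x) ν` satisfies the drift inequality with constant
`max 0 (L - ν V)` and has mass `1 - ν(1) 1_S(x)`. -/
theorem exists_residual_measure [IsMarkovKernel P] [IsFiniteMeasure ν]
    (h : Drift V P S δ L) (hδ₀ : 0 < δ) (hL : 0 < L) (hmin : Minorization P S ν)
    (hν : Integrable V.toFun ν) (hS : MeasurableSet S) (x : X) :
    ∃ μ : Measure X, IsFiniteMeasure μ ∧ Integrable V.toFun μ ∧
      (∀ f : WeightedSup V, (kernelOp V P (h.weightBounded hδ₀ hL) -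
        (integralCLM hν).smulRight (indicatorOne V hS)) f x = ∫ y, f y ∂μ) ∧
      ∫ y, V y ∂μ ≤ δ * V x +
        max 0 (L - ∫ y, V y ∂ν) * S.indicator (fun _ => (1 : ℝ)) x ∧
      μ.real Set.univ = 1 - ν.real Set.univ * S.indicator (fun _ => (1 : ℝ)) x := by
  have hVx := (h.weightBounded hδ₀ hL).integrable_weight x
  have hint := h.integral_le hδ₀ hL x
  have happ : ∀ f : WeightedSup V, (kernelOp V P (h.weightBounded hδ₀ hL) -
      (integralCLM hν).smulRight (indicatorOne V hS)) f x =
      ∫ y, f y ∂(P x) - (∫ y, f y ∂ν) * S.indicator (fun _ => (1 : ℂ)) x := fun f => rfl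
  by_cases hx : x ∈ S
  · have hle := hmin.le hx
    have hadd := Measure.sub_add_cancel_of_le hle
    have hfin : IsFiniteMeasure (P x - ν) := isFiniteMeasure_of_le _ Measure.sub_le
    have hVμ : Integrable V.toFun (P x - ν) := hVx.mono_measure Measure.sub_le
    refine ⟨P x - ν, hfin, hVμ, fun f => ?_, ?_, ?_⟩
    · rw [happ]
      nth_rewrite 1 [← hadd]
      rw [integral_add_measure (integrable_of_integrable_weight hVμ f)
        (integrable_of_integrable_weight hν f)]
      simp [hx]
    · rw [← hadd, integral_add_measure hVμ hν] at hint
      simp only [hx, Set.indicator_of_mem, mul_one] at hint ⊢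
      linarith [le_max_right 0 (L - ∫ y, V y ∂ν)]
    · have h1 : (P x).real Set.univ = 1 := probReal_univ
      rw [← hadd, measureReal_add_apply] at h1
      simp only [hx, Set.indicator_of_mem, mul_one]
      linarith
  · refine ⟨P x, inferInstance, hVx, fun f => ?_, ?_, ?_⟩
    · rw [happ]; simp [hx]
    · simpa [hx] using hint
    · simp [hx]

/-- The shift `τ / ν(1)` is tuned so that the gain `τ 1_S` in the drift of `V` cancels the mass
`ν(1) 1_S` lost by the residual, leaving `R(V + τ/ν(1)) ≤ δ V + τ/ν(1)`. -/
theorem norm_residual_pow_apply_le [IsMarkovKernel P] [IsFiniteMeasure ν]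
    (h : Drift V P S δ L) (hδ₀ : 0 < δ) (hδ₁ : δ < 1) (hL : 0 < L) (hmin : Minorization P S ν)
    (hν : Integrable V.toFun ν) (hS : MeasurableSet S) (hν0 : 0 < ν.real Set.univ) {τ : ℝ}
    (hτ : τ = max 0 (L - ∫ y, V y ∂ν)) (f : WeightedSup V) (n : ℕ) : ∀ x,
    ‖((kernelOp V P (h.weightBounded hδ₀ hL) -
        (integralCLM hν).smulRight (indicatorOne V hS)) ^ n) f x‖ ≤
      ‖f‖ * ((δ * ν.real Set.univ + τ) / (ν.real Set.univ + τ)) ^ n *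
        (V x + τ / ν.real Set.univ) := by
  have hτ0 : 0 ≤ τ := hτ ▸ le_max_left _ _
  set N := ν.real Set.univ
  set β := (δ * N + τ) / (N + τ) with hβ
  have hβ0 : 0 ≤ β := by positivity
  induction n with
  | zero =>
    intro x
    have h1 := WeightedSup.norm_apply_le f x
    have h2 : 0 ≤ ‖f‖ * (τ / N) := by positivity
    simp only [pow_zero, mul_one, one_apply_eq_self]
    linarith
  | succ n ih =>
    intro x
    obtain ⟨μ, hμ, hVμ, hR, hVle, hmass⟩ :=
      exists_residual_measure h hδ₀ hL hmin hν hS x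
    rw [← hτ] at hVle
    rw [pow_succ']
    change ‖(kernelOp V P (h.weightBounded hδ₀ hL) -
        (integralCLM hν).smulRight (indicatorOne V hS)) (((kernelOp V P (h.weightBounded hδ₀ hL) -
        (integralCLM hν).smulRight (indicatorOne V hS)) ^ n) f) x‖ ≤ _
    rw [hR]
    have h0 : 0 ≤ ‖f‖ * β ^ n := by positivity
    refine (norm_integral_le_affine hVμ _ (s := ‖f‖ * β ^ n) (c := ‖f‖ * β ^ n * (τ / N))
      fun y => (ih y).trans (by rw [mul_add])).trans ?_
    have h1 : ∫ y, V y ∂μ + τ / N * μ.real Set.univ ≤ δ * V x + τ / N := by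
      have : τ / N * N = τ := div_mul_cancel₀ _ hν0.ne'
      rw [hmass, mul_sub, ← mul_assoc, this]
      linarith
    -- The ratio of the two sides is largest at `V x = 1`, where it equals `β`; this is where `V ≥
    -- 1` enters.
    have h2 : δ * V x + τ / N ≤ β * (V x + τ / N) := by
      rw [hβ, div_mul_eq_mul_div, le_div_iff₀ (by positivity)]
      have h3 : τ / N * N = τ := div_mul_cancel₀ _ hν0.ne'
      have h4 : (δ * N + τ) * (V x + τ / N) - (δ * V x + τ / N) * (N + τ) =
          τ * (1 - δ) * V x - (1 - δ) * (τ / N * N) := by ring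
      have h5 : 0 ≤ τ * (1 - δ) * (V x - 1) :=
        mul_nonneg (mul_nonneg hτ0 (by linarith)) (by linarith [V.one_le_toFun x])
      rw [h3] at h4
      linarith
    calc _ = ‖f‖ * β ^ n * (∫ y, V y ∂μ + τ / N * μ.real Set.univ) := by ring
      _ ≤ ‖f‖ * β ^ n * (β * (V x + τ / N)) := mul_le_mul_of_nonneg_left (h1.trans h2) h0
      _ = _ := by ring

theorem norm_residual_pow_le [IsMarkovKernel P] [IsFiniteMeasure ν]
    (h : Drift V P S δ L) (hδ₀ : 0 < δ) (hδ₁ : δ < 1) (hL : 0 < L) (hmin : Minorization P S ν)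
    (hν : Integrable V.toFun ν) (hS : MeasurableSet S) (hν0 : 0 < ν.real Set.univ) {τ : ℝ}
    (hτ : τ = max 0 (L - ∫ y, V y ∂ν)) (n : ℕ) :
    ‖(kernelOp V P (h.weightBounded hδ₀ hL) -
        (integralCLM hν).smulRight (indicatorOne V hS)) ^ n‖ ≤
      (1 + τ / ν.real Set.univ) * ((δ * ν.real Set.univ + τ) / (ν.real Set.univ + τ)) ^ n := by
  have hτ0 : 0 ≤ τ := hτ ▸ le_max_left _ _
  refine ContinuousLinearMap.opNorm_le_bound _ (by positivity) fun f =>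
    WeightedSup.norm_le_of_forall (by positivity) fun x => ?_
  refine (norm_residual_pow_apply_le h hδ₀ hδ₁ hL hmin hν hS hν0 hτ f n x).trans ?_
  have h1 : V x + τ / ν.real Set.univ ≤ (1 + τ / ν.real Set.univ) * V x := by
    have := mul_le_mul_of_nonneg_left (V.one_le_toFun x)
      (show 0 ≤ τ / ν.real Set.univ by positivity)
    linarith
  refine (mul_le_mul_of_nonneg_left h1 (by positivity)).trans (le_of_eq ?_)
  ring

end Kernel

/-! ### Spectral radius one, and the final assembly. -/

theorem spectralRadius_eq_one_of_powerBounded {E : Type*} [NormedAddCommGroup E]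
    [NormedSpace ℂ E] [CompleteSpace E] {T : E →L[ℂ] E} (hT : PowerBounded T) {e : E}
    (he : e ≠ 0) (hTe : T e = e) : spectralRadius ℂ T = 1 := by
  refine le_antisymm (iSup₂_le fun z hz => ?_) ?_
  · obtain ⟨C, hC⟩ := hT
    by_contra hlt
    have h1 : 1 < ‖z‖ := by
      have := not_le.1 hlt
      exact_mod_cast this
    exact hz (mem_resolventSet_of_norm_pow_le (C := C) zero_le_one
      (fun n => by simpa using hC n) h1)
  · have h1 : (1 : ℂ) ∈ spectrum ℂ T := by
      intro hmem
      have h2 := resolvent_sub_apply hmem e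
      rw [algebraMap_sub_apply, one_smul, hTe, sub_self, map_zero] at h2
      exact he h2.symm
    refine le_trans ?_ (le_iSup₂ (f := fun (k : ℂ) (_ : k ∈ spectrum ℂ T) => (‖k‖₊ : ℝ≥0∞)) 1 h1)
    simp

theorem essSpectralRadius_le_of_forall {E : Type*} [NormedAddCommGroup E] [NormedSpace ℂ E]
    {T : E →L[ℂ] E} {β : ℝ} (hβ₀ : 0 < β) (hβ₁ : β < 1)
    (h : ∀ r, β < r → r < 1 → HasSpectralSplitting T r) : essSpectralRadius T ≤ β := by
  have hbdd : BddBelow {r₀ : ℝ | 0 < r₀ ∧ r₀ < 1 ∧ HasSpectralSplitting T r₀} :=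
    ⟨0, fun r hr => hr.1.le⟩
  refine le_of_forall_gt_imp_ge_of_dense fun r hr => ?_
  obtain ⟨s, hs, hsr⟩ := exists_between (lt_min hr hβ₁)
  exact (csInf_le hbdd ⟨hβ₀.trans hs, hsr.trans_le (min_le_right _ _),
    h s hs (hsr.trans_le (min_le_right _ _))⟩).trans (hsr.le.trans (min_le_left _ _))

end DriftMinorization

theorem mainTheorem3 {X : Type*} [MeasurableSpace X] (V : DriftMinorization.Weight X)
    (P : Kernel X X) [IsMarkovKernel P] (S : Set X) (hS : MeasurableSet S)
    (ν : Measure X) (hν : ν ≠ 0) (δ L : ℝ) (hδ₀ : 0 < δ) (hδ₁ : δ < 1) (hL : 0 < L)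
    (hdrift : DriftMinorization.Drift V P S δ L)
    (hmin : DriftMinorization.Minorization P S ν)
    (T : DriftMinorization.WeightedSup V →L[ℂ] DriftMinorization.WeightedSup V)
    (hT : T = DriftMinorization.kernelOp V P (hdrift.weightBounded hδ₀ hL))
    (τ : ℝ) (hτ : τ = max 0 (L - ∫ x, V x ∂ν)) :
    DriftMinorization.PowerBounded T ∧
    spectralRadius ℂ T = 1 ∧
    DriftMinorization.QuasiCompact T ∧
    IsFiniteMeasure ν ∧ Integrable V.toFun ν ∧
    DriftMinorization.essSpectralRadius T ≤ (δ * ν.real Set.univ + τ) / (ν.real Set.univ + τ) := by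
  open DriftMinorization in
  subst hT
  have hX : Nonempty X := by
    by_contra hempty
    have := not_nonempty_iff.1 hempty
    exact hν (Measure.eq_zero_of_isEmpty ν)
  -- A single point of `S` gives `ν ≤ P(x, ·)`, hence finiteness of both `ν(1)` and `ν(V)`.
  obtain ⟨x, hx⟩ := hdrift.nonempty hδ₀ hδ₁ hL
  have hνfin : IsFiniteMeasure ν := isFiniteMeasure_of_le _ (hmin.le hx)
  have hνV : Integrable V.toFun ν :=
    ((hdrift.weightBounded hδ₀ hL).integrable_weight x).mono_measure (hmin.le hx)
  have hN : 0 < ν.real Set.univ :=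
    ENNReal.toReal_pos (Measure.measure_univ_ne_zero.2 hν) (measure_ne_top ν _)
  have hτ0 : 0 ≤ τ := hτ ▸ le_max_left _ _
  set β := (δ * ν.real Set.univ + τ) / (ν.real Set.univ + τ) with hβ
  have hβ₀ : 0 < β := by positivity
  have hβ₁ : β < 1 := by
    rw [hβ, div_lt_one (by positivity)]
    have := mul_lt_mul_of_pos_right hδ₁ hN
    linarith
  have hpb := powerBounded_kernelOp hdrift hδ₀ hδ₁ hL
  have hone := kernelOp_indicatorOne_univ (hdrift.weightBounded hδ₀ hL)
  have hone0 := indicatorOne_univ_ne_zero (V := V)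
  have hsplit : ∀ r, β < r → r < 1 →
      HasSpectralSplitting (kernelOp V P (hdrift.weightBounded hδ₀ hL)) r := by
    intro r hβr hr
    refine hasSpectralSplitting_of_rankOne (R := kernelOp V P (hdrift.weightBounded hδ₀ hL) -
      (integralCLM hνV).smulRight (indicatorOne V hS)) (φ := indicatorOne V hS)
      (ψ := integralCLM hνV) (fun f => (sub_add_cancel _ _).symm) hβ₀ hβr hr ?_ ?_ hone0 hone
    · exact fun z hz => mem_resolventSet_of_norm_pow_le hβ₀.le
        (norm_residual_pow_le hdrift hδ₀ hδ₁ hL hmin hνV hS hN hτ) hz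
    · obtain ⟨C, hC⟩ := hpb
      exact fun z hz => mem_resolventSet_of_norm_pow_le (C := C) zero_le_one
        (fun n => by simpa using hC n) hz
  obtain ⟨r, hβr, hr⟩ := exists_between hβ₁
  exact ⟨hpb, spectralRadius_eq_one_of_powerBounded hpb hone0 hone,
    ⟨r, hβ₀.trans hβr, hr, hsplit r hβr hr⟩, hνfin, hνV,
    essSpectralRadius_le_of_forall hβ₀ hβ₁ hsplit⟩
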